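/- Let $p\in(0,1)$ and let $H$ be a finite graph with at least one edge. For a finite graph $G$, let $G_p$ be the random subgraph of $G$ on the same vertex set obtained by including each edge of $G$ with probability $p$, independently. For a finite graph $F$, let $X_H(F)$ denote the number of copies of $H$ in $F$, that is, the number of (not necessarily induced) subgraphs of $F$ that are isomorphic to $H$. Then: 1. There is a constant $C=C(p,H)$ such that for every finite graph $G$, every integer $r\ge 1$ such that $G$ has $r$ pairwise edge-disjoint subgraphs isomorphic to $H$, and every integer $x\ge 0$, $$\Pr\bigl(X_H(G_p)=x\bigr)\le \frac{C}{\sqrt r}.$$ 2. In particular, there is a constant $C'=C'(p,H)$ such that for every integer $n\ge 1$ and every integer $x\ge 0$, the binomial random graph $\mathbb{G}(n,p)$ (the random graph on a set of $n$ vertices in which each pair of vertices is an edge with probability $p$, independently) satisfies $$\Pr\bigl(X_H(\mathbb{G}(n,p))=x\bigr)\le \frac{C'}{n}.$$ -/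

import Mathlib

open MeasureTheory ProbabilityTheory

namespace SubgraphCounts

/-- The law of the random subgraph `G_p` of `G`: the vertex set is kept, and every edge of `G` is
kept with probability `p`, independently of the other edges. It is the push-forward of the
`p`-Bernoulli random subset of the edge set of `G` under the map that sends a set of edges to the
graph with these edges. -/
noncomputable def randomSubgraph {V : Type*} (G : SimpleGraph V) (p : unitInterval) :
    Measure (SimpleGraph V) :=
  (setBernoulli G.edgeSet p).map SimpleGraph.fromEdgeSet

/-- `G` has `r` edge-disjoint copies of `H`: there are `r` (not necessarily induced) subgraphs
of `G`, each isomorphic to `H`, no two of which share an edge. -/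
def HasEdgeDisjointCopies {V W : Type*} (G : SimpleGraph V) (H : SimpleGraph W) (r : ℕ) : Prop :=
  ∃ c : Fin r → G.Subgraph, (∀ i, Nonempty (H ≃g (c i).coe)) ∧
    Pairwise fun i j => Disjoint (c i).edgeSet (c j).edgeSet

end SubgraphCounts

namespace SubgraphCounts

open Finset

/-! Adding edges never lowers the count of copies, and completing a copy raises it strictly. Choose
one pivot edge in each of the `r` edge-disjoint copies and expose all other edges first. With `s = p
^ (e(H) - 1)`, the number `M` of copies lacking at most their pivot has mean `r * s`, and by
Chebyshev it is at least `r * s / 2` except with probability `O(1/r)`. Given this exposure, and the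
pivots of the other copies, each new pivot among the `M` live ones increases the count, so the pivot
sets giving count exactly `x` form an antichain. The biased Sperner bound then gives `O(1/√M)`. This
is `bernExp_indicator_le_of_blocks`; `copyCount_lt_copyCount` supplies the monotonicity. Sperner's
bound is the LYM inequality combined with the `O(1/√n)` bound on binomial point probabilities. For
the second claim, `K_n` contains on the order of `n ^ 2` edge-disjoint copies of `H`. -/

/-! ### Point probabilities of the binomial distribution. -/

/-- The probability that a binomial random variable with parameters `n` and `p` equals `k`. -/
noncomputable def binomialWeight (n : ℕ) (p : ℝ) (k : ℕ) : ℝ :=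
  n.choose k * p ^ k * (1 - p) ^ (n - k)

lemma binomialWeight_nonneg {p : ℝ} (hp0 : 0 ≤ p) (hp1 : p ≤ 1) (n k : ℕ) :
    0 ≤ binomialWeight n p k := by
  have := sub_nonneg.2 hp1
  unfold binomialWeight
  positivity

lemma eval_bernsteinPolynomial (n : ℕ) (p : ℝ) (k : ℕ) :
    (bernsteinPolynomial ℝ n k).eval p = binomialWeight n p k := by
  simp [bernsteinPolynomial, binomialWeight]

lemma sum_binomialWeight (n : ℕ) (p : ℝ) : ∑ k ∈ range (n + 1), binomialWeight n p k = 1 := by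
  have := congrArg (Polynomial.eval p) (bernsteinPolynomial.sum ℝ n)
  simpa [Polynomial.eval_finsetSum, eval_bernsteinPolynomial] using this

lemma sum_sq_mul_binomialWeight (n : ℕ) (p : ℝ) :
    ∑ k ∈ range (n + 1), (n * p - k) ^ 2 * binomialWeight n p k = n * p * (1 - p) := by
  have := congrArg (Polynomial.eval p) (bernsteinPolynomial.variance ℝ n)
  simpa [Polynomial.eval_finsetSum, eval_bernsteinPolynomial] using this

lemma succ_mul_binomialWeight_succ {n k : ℕ} (hk : k ≤ n) (p : ℝ) :
    (k + 1) * (1 - p) * binomialWeight n p (k + 1) = (n - k) * p * binomialWeight n p k := by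
  obtain rfl | hlt := hk.eq_or_lt
  · simp [binomialWeight]
  · have h : ((n.choose (k + 1) : ℕ) : ℝ) * (k + 1) = n.choose k * (n - k) := by
      rw [← Nat.cast_sub hk]
      exact_mod_cast Nat.choose_succ_right_eq n k
    obtain ⟨j, rfl⟩ := Nat.exists_eq_add_of_lt hlt
    have h1 : k + j + 1 - k = j + 1 := by omega
    have h2 : k + j + 1 - (k + 1) = j := by omega
    simp only [binomialWeight, h1, h2, pow_succ]
    linear_combination (p ^ k * p * (1 - p) ^ j * (1 - p)) * h

/-- De Moivre's identity for the truncated mean deviation of the binomial distribution. -/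
lemma sum_range_sub_mul_binomialWeight (n : ℕ) (p : ℝ) {k : ℕ} (hk : k ≤ n + 1) :
    ∑ j ∈ range k, (n * p - j) * binomialWeight n p j = k * (1 - p) * binomialWeight n p k := by
  induction k with
  | zero => simp
  | succ k ih =>
    have h := succ_mul_binomialWeight_succ (Nat.succ_le_succ_iff.1 hk) p
    rw [sum_range_succ, ih (by omega)]
    push_cast
    linear_combination -h

/-- AM-GM bounds `|t|` by a multiple of `t ^ 2` plus a constant, balanced at `|t| = √n`; the
variance is at most `n`. -/
lemma sum_abs_mul_binomialWeight_le {p : ℝ} (hp0 : 0 ≤ p) (hp1 : p ≤ 1) (n : ℕ) :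
    ∑ k ∈ range (n + 1), |n * p - k| * binomialWeight n p k ≤ √n := by
  obtain rfl | hn := n.eq_zero_or_pos
  · simp
  have hs : 0 < √(n : ℝ) := by positivity
  have hs2 : √(n : ℝ) ^ 2 = n := Real.sq_sqrt (by positivity)
  have key : ∀ t : ℝ, |t| ≤ t ^ 2 / (2 * √n) + √n / 2 := fun t => by
    rw [← sq_abs t, div_add_div _ _ (by positivity) (by positivity), le_div_iff₀ (by positivity)]
    nlinarith [sq_nonneg (|t| - √n)]
  calc
    _ ≤ ∑ k ∈ range (n + 1), ((1 / (2 * √n)) * ((n * p - k) ^ 2 * binomialWeight n p k)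
          + √n / 2 * binomialWeight n p k) := by
        refine sum_le_sum fun k _ => ?_
        have := mul_le_mul_of_nonneg_right (key (n * p - k)) (binomialWeight_nonneg hp0 hp1 n k)
        refine this.trans_eq (by ring)
    _ = (n * p * (1 - p)) / (2 * √n) + √n / 2 := by
        rw [sum_add_distrib, ← mul_sum, ← mul_sum, sum_sq_mul_binomialWeight, sum_binomialWeight]
        ring
    _ ≤ √n := by
        have : (n * p * (1 - p)) / (2 * √(n : ℝ)) ≤ √n / 2 := by
          rw [div_le_iff₀ (by positivity)]
          have h1 : p * (1 - p) ≤ 1 := by nlinarith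
          have h2 : (n : ℝ) * (p * (1 - p)) ≤ n * 1 := by gcongr
          nlinarith
        linarith

/-- De Moivre's identity at `k` and at `k + 1` bounds both `k * (1 - p)` and `(n - k) * p` times the
weight by the mean deviation, hence by `√n`. The two coefficients add up to at least `n * m`, which
avoids Stirling's formula. -/
lemma binomialWeight_mul_sqrt_le {p m : ℝ} (hp0 : 0 ≤ p) (hp1 : p ≤ 1) (hmp : m ≤ p)
    (hmq : m ≤ 1 - p) {n k : ℕ} (hk : k ≤ n) : m * √n * binomialWeight n p k ≤ 2 := by
  obtain rfl | hn := n.eq_zero_or_pos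
  · simp
  have hb := binomialWeight_nonneg hp0 hp1 n k
  have partial_le : ∀ l ≤ n + 1, ∑ j ∈ range l, (n * p - j) * binomialWeight n p j ≤ √n := by
    intro l hl
    refine le_trans ?_ (sum_abs_mul_binomialWeight_le hp0 hp1 n)
    refine (sum_le_sum fun j _ => mul_le_mul_of_nonneg_right (le_abs_self _)
      (binomialWeight_nonneg hp0 hp1 n j)).trans ?_
    exact sum_le_sum_of_subset_of_nonneg (range_subset_range.2 hl) fun j _ _ =>
      mul_nonneg (abs_nonneg _) (binomialWeight_nonneg hp0 hp1 n j)
  have h1 := partial_le k (by omega)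
  have h2 := partial_le (k + 1) (by omega)
  rw [sum_range_sub_mul_binomialWeight n p (by omega)] at h1 h2
  push_cast at h2
  rw [succ_mul_binomialWeight_succ hk] at h2
  have hs : 0 < √(n : ℝ) := by positivity
  have hs2 : √(n : ℝ) * √n = n := Real.mul_self_sqrt (by positivity)
  have hkn : (k : ℝ) ≤ n := by exact_mod_cast hk
  have h3 : (k : ℝ) * m * binomialWeight n p k ≤ k * (1 - p) * binomialWeight n p k := by gcongr
  have h4 : (n - k : ℝ) * m * binomialWeight n p k ≤ (n - k) * p * binomialWeight n p k := by
    have : (0 : ℝ) ≤ n - k := by linarith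
    gcongr
  have h5 : √n * (m * √n * binomialWeight n p k) ≤ √n * 2 := by
    calc √n * (m * √n * binomialWeight n p k) = (√n * √n) * m * binomialWeight n p k := by ring
      _ ≤ √n * 2 := by rw [hs2]; linarith
  exact le_of_mul_le_mul_left h5 hs

/-! ### Expectations over Bernoulli random subsets of a finite set. -/

variable {α : Type*}

/-- The expectation of `f S`, where `S` is the random subset of `E` that contains each element
with probability `p`, independently. -/
noncomputable def bernExp (p : ℝ) (E : Finset α) (f : Finset α → ℝ) : ℝ :=
  ∑ S ∈ E.powerset, p ^ #S * (1 - p) ^ (#E - #S) * f S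

lemma bernExp_empty (p : ℝ) (f : Finset α → ℝ) : bernExp p ∅ f = f ∅ := by simp [bernExp]

lemma bernExp_congr {p : ℝ} {E : Finset α} {f g : Finset α → ℝ} (h : ∀ S ⊆ E, f S = g S) :
    bernExp p E f = bernExp p E g :=
  sum_congr rfl fun S hS => by rw [h S (mem_powerset.1 hS)]

lemma bernExp_mono {p : ℝ} (hp0 : 0 ≤ p) (hp1 : p ≤ 1) {E : Finset α} {f g : Finset α → ℝ}
    (h : ∀ S ⊆ E, f S ≤ g S) : bernExp p E f ≤ bernExp p E g := by
  have := sub_nonneg.2 hp1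
  exact sum_le_sum fun S hS => mul_le_mul_of_nonneg_left (h S (mem_powerset.1 hS)) (by positivity)

lemma bernExp_add (p : ℝ) (E : Finset α) (f g : Finset α → ℝ) :
    bernExp p E (fun S => f S + g S) = bernExp p E f + bernExp p E g := by
  simp [bernExp, mul_add, sum_add_distrib]

lemma bernExp_const_mul (p : ℝ) (E : Finset α) (c : ℝ) (f : Finset α → ℝ) :
    bernExp p E (fun S => c * f S) = c * bernExp p E f := by
  rw [bernExp, bernExp, mul_sum]
  exact sum_congr rfl fun S _ => by ring

lemma bernExp_sum {ι : Type*} (p : ℝ) (E : Finset α) (s : Finset ι) (f : ι → Finset α → ℝ) :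
    bernExp p E (fun S => ∑ i ∈ s, f i S) = ∑ i ∈ s, bernExp p E (f i) := by
  simp only [bernExp, mul_sum]
  exact sum_comm

variable [DecidableEq α]

lemma bernExp_insert (p : ℝ) {E : Finset α} {a : α} (ha : a ∉ E) (f : Finset α → ℝ) :
    bernExp p (insert a E) f
      = (1 - p) * bernExp p E f + p * bernExp p E (fun S => f (insert a S)) := by
  simp only [bernExp]
  rw [sum_powerset_insert ha, mul_sum, mul_sum]
  congr 1
  · refine sum_congr rfl fun S hS => ?_
    have hS := mem_powerset.1 hS
    rw [card_insert_of_notMem ha, Nat.succ_sub (card_le_card hS), pow_succ]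
    ring
  · refine sum_congr rfl fun S hS => ?_
    have hS := mem_powerset.1 hS
    rw [card_insert_of_notMem ha, card_insert_of_notMem fun h => ha (hS h), Nat.succ_sub_succ,
      pow_succ]
    ring

lemma bernExp_const (p : ℝ) (E : Finset α) (c : ℝ) : bernExp p E (fun _ => c) = c := by
  induction E using Finset.induction_on with
  | empty => exact bernExp_empty ..
  | insert a E ha ih =>
    rw [bernExp_insert p ha, ih]
    ring

lemma bernExp_union (p : ℝ) {P Q : Finset α} (h : Disjoint Q P) (f : Finset α → ℝ) :
    bernExp p (Q ∪ P) f = bernExp p Q (fun Y => bernExp p P (fun Z => f (Y ∪ Z))) := by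
  induction Q using Finset.induction_on generalizing f with
  | empty => simp [bernExp_empty]
  | insert a Q ha ih =>
    rw [disjoint_insert_left] at h
    rw [insert_union, bernExp_insert p (by simp [ha, h.1]), bernExp_insert p ha, ih h.2, ih h.2]
    simp only [insert_union]

lemma bernExp_le_of_forall_le {p : ℝ} (hp0 : 0 ≤ p) (hp1 : p ≤ 1) {E : Finset α}
    {f : Finset α → ℝ} {c : ℝ} (h : ∀ S ⊆ E, f S ≤ c) : bernExp p E f ≤ c :=
  (bernExp_mono hp0 hp1 h).trans_eq (bernExp_const ..)

lemma bernExp_indicator_superset (p : ℝ) {E T : Finset α} (hT : T ⊆ E) :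
    bernExp p E (fun S => if T ⊆ S then 1 else 0) = p ^ #T := by
  rw [← sdiff_union_of_subset hT, bernExp_union p sdiff_disjoint, ← bernExp_const p (E \ T) (p ^ #T)]
  refine bernExp_congr fun Y hY => ?_
  -- Once the part `Y` outside `T` is fixed, only the full set `Z = T` contributes.
  rw [bernExp, sum_eq_single_of_mem T (by simp)]
  · simp
  · intro Z hZ hne
    rw [if_neg, mul_zero]
    intro h
    refine hne (Subset.antisymm (mem_powerset.1 hZ) fun a ha => ?_)
    have := h ha
    have := @hY a
    grind

/-! ### Antichains, second moments and disjoint blocks. -/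

/-- The `p`-biased form of Sperner's theorem. -/
lemma bernExp_indicator_antichain_le {p m : ℝ} (hp0 : 0 ≤ p) (hp1 : p ≤ 1) (hmp : m ≤ p)
    (hmq : m ≤ 1 - p) (P : Finset α) (A : Set (Finset α)) [DecidablePred (· ∈ A)]
    (hA : ∀ S T, T ⊆ P → S ⊂ T → S ∈ A → T ∉ A) :
    m * √(#P : ℝ) * bernExp p P (fun S => if S ∈ A then 1 else 0) ≤ 2 := by
  -- LYM is applied with `P` itself as the ground type, so that the binomial coefficients are those
  -- of `#P`.
  set 𝒜 : Finset (Finset P) := {S | S.map (Function.Embedding.subtype _) ∈ A} with h𝒜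
  have hanti : IsAntichain (· ⊆ ·) (SetLike.coe 𝒜) := by
    intro S hS T hT hne hsub
    have hS : S.map (Function.Embedding.subtype _) ∈ A := by simpa [h𝒜] using hS
    have hT : T.map (Function.Embedding.subtype _) ∈ A := by simpa [h𝒜] using hT
    refine hA _ _ (map_subtype_subset T) ?_ hS hT
    exact ((map_subset_map.2 hsub).ssubset_of_ne fun h => hne (map_injective _ h))
  have hlym := lubell_yamamoto_meshalkin_inequality_sum_inv_choose (𝕜 := ℝ) hanti
  rw [Fintype.card_coe] at hlym
  have hsum : bernExp p P (fun S => if S ∈ A then 1 else 0)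
      = ∑ S ∈ 𝒜, p ^ #S * (1 - p) ^ (#P - #S) := by
    rw [h𝒜, sum_filter, bernExp]
    refine sum_bij' (fun S _ => S.subtype (· ∈ P)) (fun S _ => S.map (Function.Embedding.subtype _))
      (by simp) (fun S _ => mem_powerset.2 (map_subtype_subset S)) ?_ ?_ ?_
    · intro S hS
      exact subtype_map_of_mem fun x hx => mem_powerset.1 hS hx
    · intro S _
      ext x
      simp
    · intro S hS
      have h := subtype_map_of_mem (p := (· ∈ P)) fun x hx => mem_powerset.1 hS hx
      have hc : #(S.subtype (· ∈ P)) = #S := by rw [← card_map (Function.Embedding.subtype _), h]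
      rw [h, hc, mul_ite, mul_one, mul_zero]
  rw [hsum, mul_sum]
  calc
    _ ≤ ∑ S ∈ 𝒜, 2 * ((#P).choose #S : ℝ)⁻¹ := by
      refine sum_le_sum fun S _ => ?_
      have hc : #S ≤ #P := by simpa using card_le_univ S
      have := binomialWeight_mul_sqrt_le hp0 hp1 hmp hmq hc
      have hpos : (0 : ℝ) < (#P).choose #S := by exact_mod_cast Nat.choose_pos hc
      rw [← div_eq_mul_inv, le_div_iff₀ hpos]
      refine le_trans (le_of_eq ?_) this
      unfold binomialWeight
      ring
    _ ≤ 2 := by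
      rw [← mul_sum]
      linarith

/-- A variance bound: disjointness makes the off-diagonal covariances vanish, and each diagonal term
is `s - s ^ 2 ≤ s`. -/
lemma bernExp_sq_sub_le {p : ℝ} (hp0 : 0 ≤ p) {E : Finset α} {r h : ℕ} (D : Fin r → Finset α)
    (hDE : ∀ i, D i ⊆ E) (hDc : ∀ i, #(D i) = h)
    (hdisj : Pairwise fun i j => Disjoint (D i) (D j)) :
    bernExp p E (fun U => ((#{i | D i ⊆ U} : ℝ) - r * p ^ h) ^ 2) ≤ r * p ^ h := by
  set s : ℝ := p ^ h with hs
  have hs0 : 0 ≤ s := by positivity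
  have expand : ∀ U : Finset α, ((#{i | D i ⊆ U} : ℝ) - r * s) ^ 2
      = ∑ i, ∑ j, ((if D i ∪ D j ⊆ U then 1 else 0) + ((-s) * (if D i ⊆ U then 1 else 0)
        + ((-s) * (if D j ⊆ U then 1 else 0) + s ^ 2))) := by
    intro U
    have h1 : (#{i | D i ⊆ U} : ℝ) - r * s = ∑ i, ((if D i ⊆ U then 1 else 0) - s) := by
      simp [sum_sub_distrib]
    rw [h1, sq, sum_mul_sum]
    refine sum_congr rfl fun i _ => sum_congr rfl fun j _ => ?_
    simp only [union_subset_iff, ite_and]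
    split_ifs <;> ring
  simp_rw [expand, bernExp_sum, bernExp_add, bernExp_const_mul, bernExp_const,
    bernExp_indicator_superset p (hDE _), bernExp_indicator_superset p
      (union_subset (hDE _) (hDE _)), hDc]
  calc
    _ ≤ ∑ i : Fin r, ∑ j : Fin r, if i = j then s else 0 := by
      refine sum_le_sum fun i _ => sum_le_sum fun j _ => ?_
      split_ifs with hij
      · subst hij
        rw [union_self, hDc, ← hs]
        nlinarith
      · rw [card_union_of_disjoint (hdisj hij), hDc, hDc, pow_add, ← hs]
        nlinarith
    _ = r * s := by simp

/-- If every pair of nested members of `A` contains the same blocks among `r` disjoint blocks of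
equal size, then `A` is hit by a Bernoulli random subset with probability `O(1 / √r)`. -/
theorem bernExp_indicator_le_of_blocks {p m : ℝ} (hp0 : 0 < p) (hp1 : p ≤ 1) (hmp : m ≤ p)
    (hmq : m ≤ 1 - p) (hm : 0 < m) {E : Finset α} {r h : ℕ} (hr : 0 < r) (B : Fin r → Finset α)
    (hBE : ∀ i, B i ⊆ E) (hBc : ∀ i, #(B i) = h + 1)
    (hdisj : Pairwise fun i j => Disjoint (B i) (B j)) (A : Set (Finset α)) [DecidablePred (· ∈ A)]
    (hA : ∀ S T, S ⊆ T → T ⊆ E → S ∈ A → T ∈ A → ∀ i, B i ⊆ T → B i ⊆ S) :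
    bernExp p E (fun S => if S ∈ A then 1 else 0) ≤ (4 / p ^ h + 4 / (m * p ^ h)) / √(r : ℝ) := by
  have hne : ∀ i, (B i).Nonempty := fun i => card_pos.1 (by rw [hBc]; omega)
  -- The pivots: `R` collects them and `D i` is the rest of block `i`, disjoint from `R`.
  choose e he using hne
  have einj : Function.Injective e := fun i j hij => by
    by_contra hn
    exact disjoint_left.1 (hdisj hn) (he i) (hij ▸ he j)
  set R : Finset α := univ.image e with hR
  have hRE : R ⊆ E := by
    rw [hR, image_subset_iff]
    exact fun i _ => hBE i (he i)
  set D : Fin r → Finset α := fun i => (B i).erase (e i) with hD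
  have hDE : ∀ i, D i ⊆ E \ R := by
    intro i a ha
    obtain ⟨hne, haB⟩ := mem_erase.1 ha
    refine mem_sdiff.2 ⟨hBE i haB, fun hmem => ?_⟩
    obtain ⟨j, -, rfl⟩ := mem_image.1 hmem
    have hij : i ≠ j := by rintro rfl; exact hne rfl
    exact disjoint_left.1 (hdisj hij) haB (he j)
  have hDc : ∀ i, #(D i) = h := fun i => by rw [hD, card_erase_of_mem (he i), hBc]; rfl
  have hDdisj : Pairwise fun i j => Disjoint (D i) (D j) := fun i j hij =>
    (hdisj hij).mono (erase_subset _ _) (erase_subset _ _)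
  have ind_le_one : ∀ S : Finset α, (if S ∈ A then (1 : ℝ) else 0) ≤ 1 := fun S => by
    split_ifs <;> norm_num
  set s : ℝ := p ^ h with hs
  have hs0 : 0 < s := by positivity
  have hs1 : s ≤ 1 := pow_le_one₀ hp0.le hp1
  have hr0 : (0 : ℝ) < r := by exact_mod_cast hr
  have hr1 : (1 : ℝ) ≤ r := by exact_mod_cast hr
  have hsr : 0 < √(r : ℝ) := by positivity
  have conditional : ∀ U ⊆ E \ R, m * √(#{i | D i ⊆ U} : ℝ) *
      bernExp p R (fun Z => if U ∪ Z ∈ A then 1 else 0) ≤ 2 := by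
    intro U hU
    -- The live pivots. The remaining pivots `Y` are fixed too, so only subsets of `P` vary.
    set P : Finset α := ({i | D i ⊆ U} : Finset (Fin r)).image e with hP
    have hPR : P ⊆ R := image_subset_image (filter_subset _ _)
    have hPc : #P = #{i | D i ⊆ U} := card_image_of_injective _ einj
    rw [← sdiff_union_of_subset hPR, bernExp_union p sdiff_disjoint, ← bernExp_const_mul]
    refine bernExp_le_of_forall_le hp0.le hp1 fun Y hY => ?_
    rw [← hPc]
    have := bernExp_indicator_antichain_le hp0.le hp1 hmp hmq P {Z | U ∪ (Y ∪ Z) ∈ A} ?_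
    · simpa only [Set.mem_ofPred_eq] using this
    intro S T hTP hST hSA hTA
    have hsub : S ⊆ T := hST.1
    -- A pivot gained from `S` to `T` completes its block, so `hA` would force it into the smaller
    -- set; but it lies in none of `U`, `Y`, `S`.
    obtain ⟨a, haT, haS⟩ := exists_of_ssubset hST
    obtain ⟨i, hi, rfl⟩ := mem_image.1 (hTP haT)
    have hTE : U ∪ (Y ∪ T) ⊆ E := union_subset (hU.trans sdiff_subset)
      (union_subset (hY.trans (sdiff_subset.trans hRE)) (hTP.trans (hPR.trans hRE)))
    have hBT : B i ⊆ U ∪ (Y ∪ T) := by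
      rw [← insert_erase (he i)]
      exact insert_subset (by simp [haT]) ((mem_filter.1 hi).2.trans subset_union_left)
    have := hA _ _ (union_subset_union_right (union_subset_union_right hsub)) hTE hSA hTA i hBT
      (he i)
    rcases mem_union.1 this with h1 | h1
    · exact (mem_sdiff.1 (hU h1)).2 (hPR (hTP haT))
    · rcases mem_union.1 h1 with h1 | h1
      · exact (mem_sdiff.1 (hY h1)).2 (hTP haT)
      · exact haS h1
  have bound : ∀ U ⊆ E \ R, bernExp p R (fun Z => if U ∪ Z ∈ A then 1 else 0)
      ≤ 4 / (r * s) ^ 2 * ((#{i | D i ⊆ U} : ℝ) - r * s) ^ 2 + 4 / (m * s) / √(r : ℝ) := by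
    intro U hU
    set M : ℝ := (#{i | D i ⊆ U} : ℝ) with hM
    set g := bernExp p R (fun Z => if U ∪ Z ∈ A then 1 else 0) with hg
    have hg1 : g ≤ 1 := bernExp_le_of_forall_le hp0.le hp1 fun Z _ => ind_le_one _
    have hg0 : 0 ≤ g := by
      rw [← bernExp_const p R 0]
      exact bernExp_mono hp0.le hp1 fun Z _ => by split_ifs <;> norm_num
    have hc : m * √M * g ≤ 2 := conditional U hU
    -- Chebyshev done pointwise: if `M` is at most half its mean, the quadratic term is already at
    -- least `1`; otherwise the antichain bound applies.
    rcases le_total M (r * s / 2) with hlow | hhigh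
    · have h1 : 1 ≤ 4 / (r * s) ^ 2 * (M - r * s) ^ 2 := by
        rw [div_mul_eq_mul_div, le_div_iff₀ (by positivity)]
        have : 0 < r * s := by positivity
        nlinarith
      have : 0 ≤ 4 / (m * s) / √(r : ℝ) := by positivity
      linarith
    · have h1 : s * √(r : ℝ) / 2 ≤ √M := by
        refine Real.le_sqrt_of_sq_le (le_trans ?_ hhigh)
        have : √(r : ℝ) ^ 2 = r := Real.sq_sqrt hr0.le
        rw [div_pow, mul_pow, this]
        have : r * (s * s) ≤ r * s := by
          gcongr
          nlinarith
        nlinarith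
      have h2 : g ≤ 4 / (m * s) / √(r : ℝ) := by
        rw [div_div, le_div_iff₀ (by positivity)]
        have : m * (s * √(r : ℝ) / 2) * g ≤ m * √M * g := by gcongr
        linarith
      have : 0 ≤ 4 / (r * s) ^ 2 * (M - r * s) ^ 2 := by positivity
      linarith
  calc
    _ = bernExp p (E \ R) (fun U => bernExp p R (fun Z => if U ∪ Z ∈ A then 1 else 0)) := by
      have := bernExp_union p (P := R) (Q := E \ R) sdiff_disjoint fun S => if S ∈ A then 1 else 0
      rwa [sdiff_union_of_subset hRE] at this
    _ ≤ 4 / (r * s) ^ 2 * (r * s) + 4 / (m * s) / √(r : ℝ) := by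
      refine (bernExp_mono hp0.le hp1 bound).trans ?_
      rw [bernExp_add, bernExp_const_mul, bernExp_const]
      gcongr
      exact bernExp_sq_sub_le hp0.le D hDE hDc hDdisj
    _ ≤ _ := by
      rw [add_div]
      gcongr
      have : √(r : ℝ) ≤ r := by
        rw [Real.sqrt_le_left hr0.le]
        nlinarith
      calc 4 / (r * s) ^ 2 * (r * s) = 4 / s / r := by field_simp
        _ ≤ 4 / s / √(r : ℝ) := by gcongr

/-! ### Copy counts and the random subgraph. -/

lemma copyCount_eq_ncard {V W : Type*} [Fintype V] (G : SimpleGraph V) (H : SimpleGraph W) :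
    G.copyCount H = {G' : G.Subgraph | Nonempty (H ≃g G'.coe)}.ncard := by
  classical
  rw [SimpleGraph.copyCount, ← Set.ncard_coe_finset]
  congr 1
  ext
  simp

/-- A subgraph of `G` whose adjacency relation is contained in that of `G'`, as a subgraph
of `G'`. -/
def transferSubgraph {V : Type*} {G : SimpleGraph V} (G' : SimpleGraph V) (c : G.Subgraph)
    (h : ∀ v w, c.Adj v w → G'.Adj v w) : G'.Subgraph where
  verts := c.verts
  Adj := c.Adj
  adj_sub := fun {v w} hvw => h v w hvw
  edge_vert := c.edge_vert
  symm := c.symm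

/-- Copies in `G₁` inject into those in `G₂`, and `c` is a copy in `G₂` outside the image. -/
lemma copyCount_lt_copyCount {V W : Type*} [Fintype V] {G G₁ G₂ : SimpleGraph V}
    {H : SimpleGraph W} (hle : G₁ ≤ G₂) (c : G.Subgraph) (hc : Nonempty (H ≃g c.coe))
    (h₂ : c.edgeSet ⊆ G₂.edgeSet) (h₁ : ¬ c.edgeSet ⊆ G₁.edgeSet) :
    G₁.copyCount H < G₂.copyCount H := by
  classical
  rw [copyCount_eq_ncard, copyCount_eq_ncard]
  let φ : G₁.Subgraph → G₂.Subgraph := fun c =>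
    transferSubgraph G₂ c fun v w hvw => hle (c.adj_sub hvw)
  have hφ : Function.Injective φ := fun c d hcd => by
    have h1 := congrArg SimpleGraph.Subgraph.verts hcd
    have h2 := congrArg SimpleGraph.Subgraph.Adj hcd
    exact SimpleGraph.Subgraph.ext h1 h2
  rw [← Set.ncard_image_of_injective _ hφ]
  refine Set.ncard_lt_ncard (Set.ssubset_iff_exists.2 ⟨?_, ?_⟩) (Set.toFinite _)
  · rintro _ ⟨d, hd, rfl⟩
    exact hd
  · refine ⟨transferSubgraph G₂ c fun v w hvw =>
      h₂ (SimpleGraph.Subgraph.mem_edgeSet.2 hvw), hc, ?_⟩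
    rintro ⟨d, -, hdc⟩
    refine h₁ fun a => ?_
    induction a using Sym2.ind with
    | _ v w =>
      intro ha
      have h2 : d.Adj = c.Adj := congrArg SimpleGraph.Subgraph.Adj hdc
      exact d.adj_sub (h2 ▸ SimpleGraph.Subgraph.mem_edgeSet.1 ha)

lemma ncard_edgeSet_of_iso {V W : Type*} {G : SimpleGraph V} {H : SimpleGraph W} (c : G.Subgraph)
    (φ : H ≃g c.coe) : c.edgeSet.ncard = H.edgeSet.ncard := by
  rw [← c.image_coe_edgeSet_coe, Set.ncard_image_of_injective _
    (Sym2.map.injective Subtype.val_injective)]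
  exact (Nat.card_congr φ.mapEdgeSet).symm

lemma randomSubgraph_real_eq_bernExp {V : Type*} [Fintype V] (G : SimpleGraph V)
    (p : unitInterval) (E : Finset (Sym2 V)) (hE : (E : Set (Sym2 V)) = G.edgeSet)
    (𝒢 : Set (SimpleGraph V)) (A : Set (Finset (Sym2 V))) [DecidablePred (· ∈ A)]
    (hA : ∀ S : Finset (Sym2 V), S ∈ A ↔ SimpleGraph.fromEdgeSet (S : Set (Sym2 V)) ∈ 𝒢) :
    (randomSubgraph G p).real 𝒢 = bernExp p E (fun S => if S ∈ A then 1 else 0) := by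
  classical
  have h𝒢 : MeasurableSet 𝒢 :=
    SimpleGraph.measurableEmbedding_edgeSet.measurableSet_image.1 (Set.toFinite _).measurableSet
  rw [randomSubgraph, map_measureReal_apply SimpleGraph.measurable_fromEdgeSet h𝒢,
    measureReal_def, setBernoulli_apply_eq_apply_subsets, ← measureReal_def]
  have hset : {s | s ∈ SimpleGraph.fromEdgeSet ⁻¹' 𝒢 ∧ s ⊆ G.edgeSet}
      = ⋃ S ∈ E.powerset.filter (· ∈ A), {(S : Set (Sym2 V))} := by
    ext s
    simp only [Set.mem_iUnion, Set.mem_singleton_iff, mem_filter, mem_powerset, hA, exists_prop,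
      Set.mem_ofPred_eq, Set.mem_preimage, ← hE]
    constructor
    · rintro ⟨h1, h2⟩
      refine ⟨E.filter (· ∈ s), ⟨filter_subset _ _, ?_⟩, ?_⟩
      · convert h1
        ext a
        simpa using @h2 a
      · ext a
        simpa using @h2 a
    · rintro ⟨S, ⟨h1, h2⟩, rfl⟩
      exact ⟨h2, by exact_mod_cast h1⟩
  rw [hset, measureReal_biUnion_finset (by intro S _ T _ h; simpa using h)
    fun S _ => (Set.toFinite _).measurableSet, bernExp, sum_filter]
  refine sum_congr rfl fun S hS => ?_
  have hS := mem_powerset.1 hS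
  rw [mul_ite, mul_one, mul_zero]
  refine if_congr Iff.rfl ?_ rfl
  rw [← hE, setBernoulli_real_singleton p (by exact_mod_cast hS) E.finite_toSet, ← coe_sdiff,
    Set.ncard_coe_finset, Set.ncard_coe_finset, card_sdiff_of_subset hS]

lemma randomSubgraph_copyCount_le {V W : Type*} [Fintype V] [Finite W] (G : SimpleGraph V)
    (H : SimpleGraph W) (hH : H.edgeSet.Nonempty) (p : unitInterval) (hp0 : 0 < p) (hp1 : p < 1)
    {r : ℕ} (hr : 0 < r) (hG : HasEdgeDisjointCopies G H r) (x : ℕ) :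
    (randomSubgraph G p).real {G' | G'.copyCount H = x} ≤
      (4 / (p : ℝ) ^ (H.edgeSet.ncard - 1)
        + 4 / (min (p : ℝ) (1 - p) * (p : ℝ) ^ (H.edgeSet.ncard - 1))) / √(r : ℝ) := by
  classical
  obtain ⟨c, hc, hdisj⟩ := hG
  have hp0' : (0 : ℝ) < p := hp0
  have hp1' : (p : ℝ) < 1 := hp1
  -- Positivity lets the block size be written as `(e(H) - 1) + 1` despite truncated subtraction.
  have hcard : 0 < H.edgeSet.ncard := (Set.ncard_pos (Set.toFinite _)).2 hH
  rw [randomSubgraph_real_eq_bernExp G p G.edgeSet.toFinite.toFinset (by simp) _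
    {S | (SimpleGraph.fromEdgeSet (S : Set (Sym2 V))).copyCount H = x} (by simp)]
  refine bernExp_indicator_le_of_blocks hp0' hp1'.le (min_le_left _ _) (min_le_right _ _)
    (lt_min hp0' (sub_pos.2 hp1')) hr (fun i => (c i).edgeSet.toFinite.toFinset)
    (fun i => by simpa using (c i).edgeSet_subset) (fun i => ?_) (fun i j hij => ?_) _ ?_
  · rw [← Set.ncard_eq_toFinset_card, ncard_edgeSet_of_iso _ (hc i).some]
    omega
  · simpa using hdisj hij
  · intro S T hST hTE hS hT i hBT
    by_contra hBS
    have hlt : (SimpleGraph.fromEdgeSet (S : Set (Sym2 V))).copyCount H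
        < (SimpleGraph.fromEdgeSet (T : Set (Sym2 V))).copyCount H := by
      refine copyCount_lt_copyCount (SimpleGraph.fromEdgeSet_mono (by exact_mod_cast hST)) (c i)
        (hc i) ?_ ?_
      · intro a ha
        rw [SimpleGraph.edgeSet_fromEdgeSet]
        exact ⟨hBT (by simpa using ha), G.not_isDiag_of_mem_edgeSet ((c i).edgeSet_subset ha)⟩
      · intro hsub
        refine hBS fun a ha => ?_
        have := hsub (by simpa using ha)
        rw [SimpleGraph.edgeSet_fromEdgeSet] at this
        exact this.1
    exact absurd (hS.trans hT.symm) hlt.ne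

/-! ### Edge-disjoint copies in the complete graph. -/

/-- The complete graph on `n ≥ h ^ 2 * m` vertices has `m ^ 2` edge-disjoint copies of every graph
on `h` vertices: place the vertex `i` of the copy with index `(a, b)` at height `a * i + b` of the
`i`-th of `h` columns of length `h * m`. -/
lemma hasEdgeDisjointCopies_top {W : Type*} [Finite W] (H : SimpleGraph W) {n m : ℕ}
    (hn : Nat.card W * (Nat.card W * m) ≤ n) :
    HasEdgeDisjointCopies (⊤ : SimpleGraph (Fin n)) H (m * m) := by
  set h := Nat.card W with hh
  let ε : W ≃ Fin h := Finite.equivFin W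
  have height : ∀ (ab : Fin m × Fin m) (i : Fin h), ab.1.1 * i + ab.2.1 < h * m := by
    rintro ⟨⟨a, ha⟩, ⟨b, hb⟩⟩ ⟨i, hi⟩
    change a * i + b < h * m
    calc a * i + b < m * i + m := by
          have := Nat.mul_le_mul_right i ha.le
          omega
      _ = (i + 1) * m := by ring
      _ ≤ h * m := Nat.mul_le_mul_right m hi
  let pos : Fin m × Fin m → W → Fin n := fun ab w =>
    ⟨(h * m) * (ε w).1 + (ab.1.1 * (ε w).1 + ab.2.1), by
      have h1 := height ab (ε w)
      have h2 := Nat.mul_le_mul_left (h * m) (Nat.succ_le_of_lt (ε w).2)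
      rw [Nat.mul_succ, mul_comm _ h] at h2
      omega⟩
  -- Column and height are recovered as quotient and remainder modulo `h * m`.
  have pos_eq : ∀ ab cd v w, pos ab v = pos cd w →
      v = w ∧ ab.1.1 * (ε v).1 + ab.2.1 = cd.1.1 * (ε v).1 + cd.2.1 := by
    intro ab cd v w heq
    have heq : (h * m) * (ε v).1 + (ab.1.1 * (ε v).1 + ab.2.1)
      = (h * m) * (ε w).1 + (cd.1.1 * (ε w).1 + cd.2.1) := congrArg Fin.val heq
    have h1 := height ab (ε v)
    have h2 := height cd (ε w)
    have hpos : 0 < h * m := by omega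
    have hd := congrArg (· / (h * m)) heq
    simp only [Nat.mul_add_div hpos, Nat.div_eq_of_lt h1, Nat.div_eq_of_lt h2, add_zero] at hd
    have hvw : v = w := ε.injective (Fin.ext hd)
    subst hvw
    exact ⟨rfl, Nat.add_left_cancel heq⟩
  let cp : Fin m × Fin m → H.Copy (⊤ : SimpleGraph (Fin n)) := fun ab =>
    ⟨⟨pos ab, fun {v w} hvw => by
      simpa using fun heq => hvw.ne (pos_eq ab ab v w heq).1⟩,
      fun v w heq => (pos_eq ab ab v w heq).1⟩
  refine ⟨fun k => (cp (finProdFinEquiv.symm k)).toSubgraph,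
    fun k => ⟨(cp _).isoToSubgraph⟩, fun k l hkl => ?_⟩
  have hne : finProdFinEquiv.symm k ≠ finProdFinEquiv.symm l := fun h =>
    hkl (finProdFinEquiv.symm.injective h)
  change Disjoint (cp (finProdFinEquiv.symm k)).toSubgraph.edgeSet
    (cp (finProdFinEquiv.symm l)).toSubgraph.edgeSet
  generalize finProdFinEquiv.symm k = ab at hne ⊢
  generalize finProdFinEquiv.symm l = cd at hne ⊢
  refine Set.disjoint_left.2 fun a => ?_
  induction a using Sym2.ind with
  | _ x y =>
    intro h1 h2
    have mem : ∀ ab, s(x, y) ∈ (cp ab).toSubgraph.edgeSet →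
        ∃ v w, H.Adj v w ∧ pos ab v = x ∧ pos ab w = y := by
      intro ab hab
      rw [SimpleGraph.Subgraph.mem_edgeSet] at hab
      exact (by simpa [SimpleGraph.Copy.toSubgraph, Relation.Map] using hab :
        ∃ v w, H.Adj v w ∧ cp ab v = x ∧ cp ab w = y)
    obtain ⟨v, w, hvw, hv, hw⟩ := mem ab h1
    obtain ⟨v', w', -, hv', hw'⟩ := mem cd h2
    obtain ⟨-, e1⟩ := pos_eq ab cd v v' (hv.trans hv'.symm)
    obtain ⟨-, e2⟩ := pos_eq ab cd w w' (hw.trans hw'.symm)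
    have hi : (ε v).1 ≠ (ε w).1 := fun h => hvw.ne (ε.injective (Fin.ext h))
    -- A shared edge makes two lines of slopes `ab.1` and `cd.1` agree in two distinct columns, so
    -- the lines coincide.
    have hz : ((ab.1.1 : ℤ) - cd.1.1) * ((ε v).1 - (ε w).1) = 0 := by
      zify at e1 e2
      linear_combination e1 - e2
    rcases mul_eq_zero.1 hz with hz | hz
    · have ha : ab.1.1 = cd.1.1 := by omega
      rw [ha] at e1
      exact hne (Prod.ext (Fin.ext ha) (Fin.ext (Nat.add_left_cancel e1)))
    · omega

lemma binomialRandom_eq_randomSubgraph_top (V : Type*) [Countable V] (p : unitInterval) :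
    SimpleGraph.binomialRandom V p = randomSubgraph ⊤ p := by
  rw [SimpleGraph.binomialRandom_eq_map, randomSubgraph, SimpleGraph.edgeSet_top]

end SubgraphCounts

theorem corollary1p6 {W : Type*} [Finite W] (H : SimpleGraph W) (hH : H.edgeSet.Nonempty)
    (p : unitInterval) (hp0 : 0 < p) (hp1 : p < 1) :
    (∃ C : ℝ, ∀ (V : Type*) [Fintype V] (G : SimpleGraph V) (r : ℕ), 0 < r →
      SubgraphCounts.HasEdgeDisjointCopies G H r → ∀ x : ℕ,
        (SubgraphCounts.randomSubgraph G p).real {G' | G'.copyCount H = x} ≤ C / √(r : ℝ)) ∧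
    (∃ C : ℝ, ∀ n : ℕ, 0 < n → ∀ x : ℕ,
        (SimpleGraph.binomialRandom (Fin n) p).real {G' | G'.copyCount H = x} ≤ C / (n : ℝ)) := by
  have hp0' : (0 : ℝ) < p := hp0
  have hp1' : (p : ℝ) < 1 := hp1
  have hmin : 0 < min (p : ℝ) (1 - p) := lt_min hp0' (sub_pos.2 hp1')
  set K : ℝ := 4 / (p : ℝ) ^ (H.edgeSet.ncard - 1)
    + 4 / (min (p : ℝ) (1 - p) * (p : ℝ) ^ (H.edgeSet.ncard - 1)) with hK
  have hK0 : 0 < K := by positivity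
  refine ⟨⟨K, fun V _ G r hr hG x =>
    SubgraphCounts.randomSubgraph_copyCount_le G H hH p hp0 hp1 hr hG x⟩, ?_⟩
  set d : ℕ := Nat.card W * Nat.card W with hd
  have hd0 : 0 < d := by
    obtain ⟨e, -⟩ := hH
    induction e using Sym2.ind with
    | _ v w =>
      have : Nonempty W := ⟨v⟩
      exact Nat.mul_pos Nat.card_pos Nat.card_pos
  -- The summand `d` covers `n < d` by the trivial bound `1`; `2 * d * K` covers `n ≥ d`, where `m =
  -- n / d` satisfies `n ≤ 2 * d * m` and there are `m * m` disjoint copies.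
  refine ⟨d + 2 * d * K, fun n hn x => ?_⟩
  have hn0 : (0 : ℝ) < n := by exact_mod_cast hn
  rw [le_div_iff₀ hn0]
  rcases lt_or_ge n d with hlt | hge
  · have hle : (SimpleGraph.binomialRandom (Fin n) p).real {G' | G'.copyCount H = x} ≤ 1 :=
      measureReal_le_one
    have : (n : ℝ) ≤ d := by exact_mod_cast hlt.le
    have : 0 ≤ 2 * d * K := by positivity
    nlinarith
  · set m := n / d with hm
    have hm0 : 0 < m := Nat.div_pos hge hd0
    have hmn : d * m ≤ n := Nat.mul_div_le n d
    have hnm : n ≤ 2 * d * m := by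
      have h1 : n < d * (m + 1) := Nat.lt_mul_div_succ n hd0
      nlinarith
    have h := SubgraphCounts.randomSubgraph_copyCount_le (⊤ : SimpleGraph (Fin n)) H hH p hp0 hp1
      (Nat.mul_pos hm0 hm0) (SubgraphCounts.hasEdgeDisjointCopies_top H (by rwa [← mul_assoc])) x
    rw [← SubgraphCounts.binomialRandom_eq_randomSubgraph_top, ← hK, Nat.cast_mul,
      Real.sqrt_mul_self m.cast_nonneg] at h
    have hm0' : (0 : ℝ) < m := by exact_mod_cast hm0
    have hnm' : (n : ℝ) ≤ 2 * d * m := by exact_mod_cast hnm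
    calc
      _ ≤ K / m * (2 * d * m) := by gcongr
      _ = 2 * d * K := by field_simp
      _ ≤ d + 2 * d * K := by simp
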